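/- Let $X$ be a Banach space over $\mathbb{K}\in\{\mathbb{R},\mathbb{C}\}$ and let $B_{X^*}$ be the closed unit ball of its dual. For $K\subseteq X^*$ and $\varepsilon>0$ let $$\iota_\varepsilon K=\{x^*\in K:\ \operatorname{diam}(K\cap U)>\varepsilon\ \text{ for every weak}^*\text{-open neighbourhood } U \text{ of } x^*\},$$ where the diameter is taken in the dual norm. Say that $X$ has \emph{summable Szlenk index with constant} $M$ if, for all $\varepsilon_1,\dots,\varepsilon_n>0$, the condition $\iota_{\varepsilon_1}\cdots\iota_{\varepsilon_n}B_{X^*}\neq\varnothing$ implies $\sum_{i=1}^n\varepsilon_i\le M$; and that $X$ has \emph{summable Szlenk index} if this holds for some real constant $M$. \textbf{Theorem.} Let $(X_n)_{n=1}^\infty$ be a sequence of separable Banach spaces over $\mathbb{K}$ for which there is a single constant $M$ such that every $X_n$ has summable Szlenk index with constant $M$. Then the $c_0$-sum $$\Bigl(\bigoplus_{n=1}^\infty X_n\Bigr)_{c_0}=\Bigl\{(x_n)_{n=1}^\infty:\ x_n\in X_n,\ \|x_n\|\to 0\Bigr\},\qquad \|(x_n)\|=\sup_n\|x_n\|,$$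 has summable Szlenk index. -/

import Mathlib

open scoped ENNReal

noncomputable section

/-- The `ε`-Szlenk derivation of a subset `K` of the dual of `E`: the points of `K` all of whose
weak-star open neighbourhoods meet `K` in a set of norm diameter greater than `ε`. -/
def szlenkDerivation {𝕜 E : Type*} [RCLike 𝕜] [NormedAddCommGroup E] [NormedSpace 𝕜 E]
    (ε : ℝ) (K : Set (WeakDual 𝕜 E)) : Set (WeakDual 𝕜 E) :=
  {f | f ∈ K ∧ ∀ U : Set (WeakDual 𝕜 E), IsOpen U → f ∈ U →
    ENNReal.ofReal ε < Metric.ediam (WeakDual.toStrongDual '' (K ∩ U))}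

/-- The closed unit ball of the dual of `E` (for the dual norm), as a subset of the dual with its
weak-star topology. -/
def dualUnitBall (𝕜 E : Type*) [RCLike 𝕜] [NormedAddCommGroup E] [NormedSpace 𝕜 E] :
    Set (WeakDual 𝕜 E) :=
  WeakDual.toStrongDual ⁻¹' Metric.closedBall (0 : StrongDual 𝕜 E) 1

/-- `E` has summable Szlenk index with constant `M`: for all positive `ε₁, …, εₙ`, if
`ι_{ε₁} ⋯ ι_{εₙ} B ≠ ∅`, where `B` is the dual unit ball, then `ε₁ + ⋯ + εₙ ≤ M`. -/
def HasSummableSzlenkIndexWith (𝕜 E : Type*) [RCLike 𝕜] [NormedAddCommGroup E]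
    [NormedSpace 𝕜 E] (M : ℝ) : Prop :=
  ∀ l : List ℝ, (∀ ε ∈ l, 0 < ε) →
    (l.foldr szlenkDerivation (dualUnitBall 𝕜 E)).Nonempty → l.sum ≤ M

/-- `E` has summable Szlenk index. -/
def HasSummableSzlenkIndex (𝕜 E : Type*) [RCLike 𝕜] [NormedAddCommGroup E]
    [NormedSpace 𝕜 E] : Prop :=
  ∃ M : ℝ, HasSummableSzlenkIndexWith 𝕜 E M

/-- The spaces `X i` have uniformly summable Szlenk index: one constant serves all of them. -/
def UniformlySummableSzlenkIndex (𝕜 : Type*) [RCLike 𝕜] {ι : Type*} (X : ι → Type*)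
    [∀ i, NormedAddCommGroup (X i)] [∀ i, NormedSpace 𝕜 (X i)] : Prop :=
  ∃ M : ℝ, ∀ i, HasSummableSzlenkIndexWith 𝕜 (X i) M

/-- The `c₀`-sum of the spaces `X n`: the sequences `x` with `x n ∈ X n` and `‖x n‖ → 0`, a
subspace of the bounded sequences with the norm `sup ‖x n‖`. -/
def c0Sum (𝕜 : Type*) [RCLike 𝕜] (X : ℕ → Type*)
    [∀ n, NormedAddCommGroup (X n)] [∀ n, NormedSpace 𝕜 (X n)] : Submodule 𝕜 (lp X ∞) where
  carrier := {x | Filter.Tendsto (fun n => ‖x n‖) Filter.atTop (nhds 0)}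
  zero_mem' := by simp
  add_mem' := by
    intro x y hx hy
    refine squeeze_zero (fun n => norm_nonneg _) (fun n => ?_)
      (by simpa using Filter.Tendsto.add hx hy)
    simpa using norm_add_le (x n) (y n)
  smul_mem' := by
    intro c x hx
    simpa [norm_smul] using Filter.Tendsto.const_mul ‖c‖ hx

end

/-!
The theorem rests on a potential on the dual of each summand that decreases along weak-star small
perturbations by at least their norm, and which can be added up over the summands.

Suppose that `E` has summable Szlenk index with constant `M ≥ 1`. For a functional `f` let `w n f`
be the supremum of `ε₁ + ⋯ + εₘ - 2 * M * r` over all `m ≤ n`, all `εᵢ > 0` and all `r` for which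
`f` lies in `ι_{ε₁} ⋯ ι_{εₘ} (r B)`, where `B` is the dual unit ball (`szlenkPotential`). By
scaling, the radii add up to at most `M * r`, while `‖f‖ ≤ r`; hence `-2 * M * ‖f‖ ≤ w n f ≤ -M *
‖f‖`. Moreover, given `n` and `η > 0`, `‖g - f‖ + w n g ≤ w (n + 1) f + η` for all `g` in the unit
ball that are weak-star close to `f` (`eventually_dualNorm_add_szlenkPotential_le`): otherwise, as
lists of at most `n` radii take only finitely many values up to a small error, many counterexamples
`g` close to `f` would share one list of radii and, nearly, one value of `r` and one distance `d` to
`f`; then `f` would survive a further derivation with a radius close to `d`, or lie in the same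
derived set if `d` is negligible, which contradicts the definition of `w (n + 1) f`.

The dual of the `c₀`-sum is the `ℓ₁`-sum of the duals. Writing `f k` for the restriction of `f` to
the `k`-th summand, `half_sum_sub_le_sum_szlenkPotential` shows by induction that
`(ε₁ + ⋯ + εₙ) / 2 - 2 * M ≤ ∑ k < N, w n (f k)` for all `N` whenever `f` lies in
`ι_{ε₁} ⋯ ι_{εₙ} B`. For the step, a perturbation `g ∈ ι_{ε₂} ⋯ ι_{εₙ} B` of `f` with
`‖g - f‖ > ε₁ / 2` is estimated coordinatewise. On finitely many coordinates the inequality above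
applies. On all the others `f` is negligible, so `‖g k - f k‖` is about `‖g k‖ ≤ M * ‖g k‖`, which
is paid for by `w n (g k) ≤ -M * ‖g k‖`. Taking `N = 0` gives `ε₁ + ⋯ + εₙ ≤ 4 * M`.
-/

open scoped ENNReal

/-! ### The dual norm and the Szlenk derivation -/

section Derivation

open Filter Topology Metric

variable {𝕜 E : Type*} [RCLike 𝕜] [NormedAddCommGroup E] [NormedSpace 𝕜 E]

/-- The dual norm, read on the dual space with its weak-star topology. -/
noncomputable def dualNorm (f : WeakDual 𝕜 E) : ℝ := ‖WeakDual.toStrongDual f‖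

/-- The closed ball of radius `r` about the origin in the dual with its weak-star topology. -/
def dualBall (𝕜 E : Type*) [RCLike 𝕜] [NormedAddCommGroup E] [NormedSpace 𝕜 E] (r : ℝ) :
    Set (WeakDual 𝕜 E) :=
  {f | dualNorm f ≤ r}

theorem dualBall_one : dualBall 𝕜 E 1 = dualUnitBall 𝕜 E := by
  ext f
  simp [dualBall, dualUnitBall, dualNorm]

theorem isClosed_dualBall (r : ℝ) : IsClosed (dualBall 𝕜 E r) := by
  have h := WeakDual.isClosed_closedBall (𝕜 := 𝕜) (E := E) 0 r
  convert h using 1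
  ext f
  simp [dualBall, dualNorm]

theorem dualBall_mono {r s : ℝ} (h : r ≤ s) : dualBall 𝕜 E r ⊆ dualBall 𝕜 E s :=
  fun _ hf => le_trans hf h

theorem dualNorm_nonneg (f : WeakDual 𝕜 E) : 0 ≤ dualNorm f := norm_nonneg _

theorem dualNorm_sub_le (f g : WeakDual 𝕜 E) : dualNorm (f - g) ≤ dualNorm f + dualNorm g := by
  simpa only [dualNorm, map_sub] using norm_sub_le _ _

theorem dualNorm_smul (c : 𝕜) (f : WeakDual 𝕜 E) : dualNorm (c • f) = ‖c‖ * dualNorm f := by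
  simp only [dualNorm, map_smul, norm_smul]

theorem ofReal_lt_ediam_iff {ε : ℝ} (hε : 0 ≤ ε) {K : Set (WeakDual 𝕜 E)} :
    ENNReal.ofReal ε < ediam (WeakDual.toStrongDual '' K) ↔
      ∃ g ∈ K, ∃ h ∈ K, ε < dualNorm (g - h) := by
  constructor
  · intro H
    by_contra! H'
    refine absurd H (not_lt.2 (ediam_le ?_))
    rintro _ ⟨g, hg, rfl⟩ _ ⟨h, hh, rfl⟩
    rw [edist_dist, dist_eq_norm, ← map_sub]
    exact ENNReal.ofReal_le_ofReal (H' g hg h hh)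
  · rintro ⟨g, hg, h, hh, H⟩
    refine lt_of_lt_of_le ?_ (edist_le_ediam_of_mem (Set.mem_image_of_mem _ hg)
      (Set.mem_image_of_mem _ hh))
    rw [edist_dist, dist_eq_norm, ← map_sub]
    exact (ENNReal.ofReal_lt_ofReal_iff_of_nonneg hε).2 H

theorem szlenkDerivation_subset (ε : ℝ) (K : Set (WeakDual 𝕜 E)) : szlenkDerivation ε K ⊆ K :=
  fun _ h => h.1

theorem szlenkDerivation_anti {ε δ : ℝ} (h : δ ≤ ε) (K : Set (WeakDual 𝕜 E)) :
    szlenkDerivation ε K ⊆ szlenkDerivation δ K := fun _ hf =>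
  ⟨hf.1, fun U hU hfU => (ENNReal.ofReal_le_ofReal h).trans_lt (hf.2 U hU hfU)⟩

theorem szlenkDerivation_mono (ε : ℝ) {K L : Set (WeakDual 𝕜 E)} (h : K ⊆ L) :
    szlenkDerivation ε K ⊆ szlenkDerivation ε L := fun _ hf =>
  ⟨h hf.1, fun U hU hfU => (hf.2 U hU hfU).trans_le
    (ediam_mono (Set.image_mono (Set.inter_subset_inter_left U h)))⟩

theorem foldr_szlenkDerivation_mono (l : List ℝ) {K L : Set (WeakDual 𝕜 E)} (h : K ⊆ L) :
    l.foldr szlenkDerivation K ⊆ l.foldr szlenkDerivation L := by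
  induction l with
  | nil => exact h
  | cons ε l ih => exact szlenkDerivation_mono ε ih

theorem foldr_szlenkDerivation_subset (l : List ℝ) (K : Set (WeakDual 𝕜 E)) :
    l.foldr szlenkDerivation K ⊆ K := by
  induction l with
  | nil => exact subset_rfl
  | cons ε l ih => exact (szlenkDerivation_subset ε _).trans ih

theorem isClosed_szlenkDerivation (ε : ℝ) {K : Set (WeakDual 𝕜 E)} (hK : IsClosed K) :
    IsClosed (szlenkDerivation ε K) := by
  rw [← isOpen_compl_iff, isOpen_iff_forall_mem_open]
  intro f hf
  by_cases hfK : f ∈ K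
  · have : ∃ U : Set (WeakDual 𝕜 E), IsOpen U ∧ f ∈ U ∧
        ¬ ENNReal.ofReal ε < ediam (WeakDual.toStrongDual '' (K ∩ U)) := by
      by_contra! H
      exact hf ⟨hfK, H⟩
    obtain ⟨U, hU, hfU, hd⟩ := this
    exact ⟨U, fun g hgU hg => hd (hg.2 U hU hgU), hU, hfU⟩
  · exact ⟨Kᶜ, fun g hg hg' => hg hg'.1, hK.isOpen_compl, hfK⟩

theorem isClosed_foldr_szlenkDerivation (l : List ℝ) {K : Set (WeakDual 𝕜 E)} (hK : IsClosed K) :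
    IsClosed (l.foldr szlenkDerivation K) := by
  induction l with
  | nil => exact hK
  | cons ε l ih => exact isClosed_szlenkDerivation ε ih

theorem mem_szlenkDerivation_of_frequently {ε : ℝ} (hε : 0 ≤ ε) {K : Set (WeakDual 𝕜 E)}
    (hK : IsClosed K) {f : WeakDual 𝕜 E} (h : ∃ᶠ g in 𝓝 f, g ∈ K ∧ ε < dualNorm (g - f)) :
    f ∈ szlenkDerivation ε K := by
  have hfK : f ∈ K := hK.mem_of_frequently_of_tendsto (h.mono fun g hg => hg.1) tendsto_id
  refine ⟨hfK, fun U hU hfU => (ofReal_lt_ediam_iff hε).2 ?_⟩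
  obtain ⟨g, ⟨hgK, hg⟩, hgU⟩ := (h.and_eventually (hU.mem_nhds hfU)).exists
  exact ⟨g, ⟨hgK, hgU⟩, f, ⟨hfK, hfU⟩, hg⟩

/-- Of two points at distance more than `ε`, one is at distance more than `ε / 2` from `f`. -/
theorem frequently_of_mem_szlenkDerivation {ε : ℝ} (hε : 0 ≤ ε) {K : Set (WeakDual 𝕜 E)}
    {f : WeakDual 𝕜 E} (h : f ∈ szlenkDerivation ε K) :
    ∃ᶠ g in 𝓝 f, g ∈ K ∧ ε / 2 < dualNorm (g - f) := by
  rw [frequently_iff]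
  intro U hU
  obtain ⟨V, hVU, hV, hfV⟩ := mem_nhds_iff.1 hU
  obtain ⟨g, hg, k, hk, hgk⟩ := (ofReal_lt_ediam_iff hε).1 (h.2 V hV hfV)
  by_cases hgf : ε / 2 < dualNorm (g - f)
  · exact ⟨g, hVU hg.2, hg.1, hgf⟩
  · refine ⟨k, hVU hk.2, hk.1, ?_⟩
    have := dualNorm_sub_le (g - f) (k - f)
    rw [sub_sub_sub_cancel_right] at this
    linarith

theorem smul_mem_szlenkDerivation {c : 𝕜} (hc : c ≠ 0) {ε : ℝ} (hε : 0 ≤ ε)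
    {K L : Set (WeakDual 𝕜 E)} (hKL : ∀ g ∈ K, c • g ∈ L) {f : WeakDual 𝕜 E}
    (hf : f ∈ szlenkDerivation ε K) : c • f ∈ szlenkDerivation (‖c‖ * ε) L := by
  refine ⟨hKL f hf.1, fun U hU hfU => (ofReal_lt_ediam_iff (by positivity)).2 ?_⟩
  obtain ⟨g, hg, k, hk, hgk⟩ := (ofReal_lt_ediam_iff hε).1
    (hf.2 ((fun g => c • g) ⁻¹' U) (hU.preimage (continuous_const_smul c)) hfU)
  refine ⟨c • g, ⟨hKL g hg.1, hg.2⟩, c • k, ⟨hKL k hk.1, hk.2⟩, ?_⟩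
  rw [← smul_sub, dualNorm_smul]
  exact mul_lt_mul_of_pos_left hgk (norm_pos_iff.2 hc)

theorem smul_mem_foldr_szlenkDerivation {c : 𝕜} (hc : c ≠ 0) {l : List ℝ} (hl : ∀ ε ∈ l, 0 < ε)
    {K L : Set (WeakDual 𝕜 E)} (hKL : ∀ g ∈ K, c • g ∈ L) :
    ∀ f ∈ l.foldr szlenkDerivation K,
      c • f ∈ (l.map (‖c‖ * ·)).foldr szlenkDerivation L := by
  induction l with
  | nil => exact hKL
  | cons ε l ih =>
    exact fun f hf => smul_mem_szlenkDerivation hc (hl ε (by simp)).le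
      (ih fun δ hδ => hl δ (by simp [hδ])) hf

/-- Rescaling of the summability condition to balls of arbitrary radius. -/
theorem HasSummableSzlenkIndexWith.sum_le {M : ℝ} (hM : HasSummableSzlenkIndexWith 𝕜 E M)
    {l : List ℝ} (hl : ∀ ε ∈ l, 0 < ε) {r : ℝ} {f : WeakDual 𝕜 E}
    (hf : f ∈ l.foldr szlenkDerivation (dualBall 𝕜 E r)) : l.sum ≤ M * r := by
  have hpos : ∀ s, 0 < s → r ≤ s → l.sum ≤ M * s := by
    intro s hs hrs
    have hs' : ‖((s⁻¹ : ℝ) : 𝕜)‖ = s⁻¹ := by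
      rw [RCLike.norm_ofReal, abs_of_pos (inv_pos.2 hs)]
    have hc : ((s⁻¹ : ℝ) : 𝕜) ≠ 0 := by
      rw [← norm_pos_iff, hs']
      exact inv_pos.2 hs
    have := hM (l.map (‖((s⁻¹ : ℝ) : 𝕜)‖ * ·)) (by
        intro ε hε
        obtain ⟨δ, hδ, rfl⟩ := List.mem_map.1 hε
        rw [hs']
        exact mul_pos (inv_pos.2 hs) (hl δ hδ))
      ⟨_, smul_mem_foldr_szlenkDerivation hc hl (L := dualUnitBall 𝕜 E) (fun g hg => by
        rw [← dualBall_one]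
        change dualNorm _ ≤ 1
        rw [dualNorm_smul, hs', inv_mul_le_iff₀ hs, mul_one]
        exact le_trans hg hrs) f hf⟩
    rw [List.sum_map_mul_left, List.map_id', hs', inv_mul_le_iff₀ hs] at this
    linarith
  have hr : 0 ≤ r := (dualNorm_nonneg f).trans (foldr_szlenkDerivation_subset l _ hf)
  -- The radius `0` cannot be rescaled to `1`, so it is reached as a limit of larger radii.
  have hlim : Tendsto (fun s => M * s) (𝓝[>] r) (𝓝 (M * r)) :=
    ((continuous_const.mul continuous_id).tendsto r).mono_left nhdsWithin_le_nhds
  refine ge_of_tendsto hlim ?_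
  filter_upwards [self_mem_nhdsWithin] with s hs
  exact hpos s (hr.trans_lt hs) (le_of_lt hs)

theorem HasSummableSzlenkIndexWith.mono {M N : ℝ} (hM : HasSummableSzlenkIndexWith 𝕜 E M)
    (h : M ≤ N) : HasSummableSzlenkIndexWith 𝕜 E N :=
  fun l hl hne => (hM l hl hne).trans h

/-- Lists of at most `n` radii bounded by `R` can be replaced, at the cost of `n * η` in the sum
and without shrinking the derived sets, by lists from a finite set: each radius is rounded down to
a multiple of `η`, and dropped if it becomes `0`. -/
theorem exists_finite_lists {η : ℝ} (hη : 0 < η) (R : ℝ) (n : ℕ) :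
    ∃ G : Set (List ℝ), G.Finite ∧ (∀ l ∈ G, l.length ≤ n ∧ ∀ ε ∈ l, 0 < ε) ∧
      ∀ l : List ℝ, l.length ≤ n → (∀ ε ∈ l, 0 < ε ∧ ε ≤ R) → ∃ l' ∈ G, l.sum ≤ l'.sum + n * η ∧
        ∀ K : Set (WeakDual 𝕜 E), l.foldr szlenkDerivation K ⊆ l'.foldr szlenkDerivation K := by
  induction n with
  | zero =>
    refine ⟨{[]}, Set.finite_singleton _, by simp, fun l hl _ => ⟨[], rfl, ?_⟩⟩
    simp [List.length_eq_zero_iff.1 (Nat.le_zero.1 hl)]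
  | succ n ih =>
    obtain ⟨G, hGfin, hG, hround⟩ := ih
    refine ⟨G ∪ Set.image2 (fun (j : ℕ) l => ((j + 1 : ℕ) * η) :: l) (Set.Iic ⌊R / η⌋₊) G,
      hGfin.union ((Set.finite_Iic _).image2 _ hGfin), ?_, ?_⟩
    · rintro l (hl | ⟨j, -, l, hl, rfl⟩)
      · exact ⟨(hG l hl).1.trans n.le_succ, (hG l hl).2⟩
      · refine ⟨by simpa using (hG l hl).1, ?_⟩
        rintro ε hε
        rcases List.mem_cons.1 hε with rfl | hε
        · positivity
        · exact (hG l hl).2 ε hε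
    · rintro (_ | ⟨ε, l⟩) hlen hl
      · obtain ⟨l', hl', hsum, hK⟩ := hround [] (by simp) (by simp)
        refine ⟨l', Or.inl hl', ?_, hK⟩
        push_cast
        linarith
      · obtain ⟨l', hl', hsum, hK⟩ := hround l (by simpa using hlen) fun δ hδ => hl δ (by simp [hδ])
        have hε := hl ε (by simp)
        have hlt : ε < (⌊ε / η⌋₊ + 1) * η := (div_lt_iff₀ hη).1 (Nat.lt_floor_add_one _)
        have hle : ⌊ε / η⌋₊ * η ≤ ε :=
          (le_div_iff₀ hη).1 (Nat.floor_le (by have := hε.1; positivity))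
        rcases hj : ⌊ε / η⌋₊ with _ | j
        · refine ⟨l', Or.inl hl', ?_, fun K => (szlenkDerivation_subset ε _).trans (hK K)⟩
          rw [hj] at hlt
          push_cast at hlt ⊢
          simp only [List.sum_cons]
          linarith
        · refine ⟨_, Or.inr ⟨j, ?_, l', hl', rfl⟩, ?_, fun K => ?_⟩
          · have : ⌊ε / η⌋₊ ≤ ⌊R / η⌋₊ := Nat.floor_mono (by have := hε.2; gcongr)
            rw [Set.mem_Iic]
            omega
          · rw [hj] at hlt
            push_cast at hlt ⊢
            simp only [List.sum_cons]
            linarith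
          · rw [hj] at hle
            exact (szlenkDerivation_anti hle _).trans (szlenkDerivation_mono _ (hK K))

end Derivation

/-! ### The Szlenk potential -/

section Potential

open Filter Topology

variable {𝕜 E : Type*} [RCLike 𝕜] [NormedAddCommGroup E] [NormedSpace 𝕜 E]

/-- The numbers `ε₁ + ⋯ + εₘ - 2 * M * r` with `m ≤ n` for which `f` lies in
`ι_{ε₁} ⋯ ι_{εₘ} (r B)`, where `B` is the dual unit ball. -/
def szlenkValues (M : ℝ) (n : ℕ) (f : WeakDual 𝕜 E) : Set ℝ :=
  {v | ∃ (l : List ℝ) (r : ℝ), l.length ≤ n ∧ (∀ ε ∈ l, 0 < ε) ∧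
    f ∈ l.foldr szlenkDerivation (dualBall 𝕜 E r) ∧ v = l.sum - 2 * M * r}

/-- The Szlenk potential of `f`: the largest total of at most `n` radii for which `f` survives the
successive derivations of some ball, penalised by `2 * M` times the radius of that ball. -/
noncomputable def szlenkPotential (M : ℝ) (n : ℕ) (f : WeakDual 𝕜 E) : ℝ :=
  sSup (szlenkValues M n f)

variable {M : ℝ}

theorem neg_mul_dualNorm_mem_szlenkValues (M : ℝ) (n : ℕ) (f : WeakDual 𝕜 E) :
    -(2 * M * dualNorm f) ∈ szlenkValues M n f :=
  ⟨[], dualNorm f, by simp, by simp, le_refl (dualNorm f), by simp⟩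

theorem szlenkValues_le (hM : HasSummableSzlenkIndexWith 𝕜 E M) (hM0 : 0 ≤ M)
    {n : ℕ} {f : WeakDual 𝕜 E} {v : ℝ}
    (hv : v ∈ szlenkValues M n f) : v ≤ -(M * dualNorm f) := by
  obtain ⟨l, r, -, hl, hf, rfl⟩ := hv
  have h1 := hM.sum_le hl hf
  have h2 : M * dualNorm f ≤ M * r :=
    mul_le_mul_of_nonneg_left (foldr_szlenkDerivation_subset l _ hf) hM0
  linarith

theorem bddAbove_szlenkValues (hM : HasSummableSzlenkIndexWith 𝕜 E M) (hM0 : 0 ≤ M)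
    (n : ℕ) (f : WeakDual 𝕜 E) :
    BddAbove (szlenkValues M n f) :=
  ⟨_, fun _ hv => szlenkValues_le hM hM0 hv⟩

/-- Since the penalty is twice the bound `M * r` for the total of the radii, half of it remains. -/
theorem szlenkPotential_le (hM : HasSummableSzlenkIndexWith 𝕜 E M) (hM0 : 0 ≤ M)
    (n : ℕ) (f : WeakDual 𝕜 E) :
    szlenkPotential M n f ≤ -(M * dualNorm f) :=
  csSup_le ⟨_, neg_mul_dualNorm_mem_szlenkValues M n f⟩ fun _ hv => szlenkValues_le hM hM0 hv

theorem neg_mul_dualNorm_le_szlenkPotential (hM : HasSummableSzlenkIndexWith 𝕜 E M) (hM0 : 0 ≤ M)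
    (n : ℕ) (f : WeakDual 𝕜 E) :
    -(2 * M * dualNorm f) ≤ szlenkPotential M n f :=
  le_csSup (bddAbove_szlenkValues hM hM0 n f) (neg_mul_dualNorm_mem_szlenkValues M n f)

theorem le_szlenkPotential (hM : HasSummableSzlenkIndexWith 𝕜 E M) (hM0 : 0 ≤ M)
    {n : ℕ} {f : WeakDual 𝕜 E} {l : List ℝ} {r : ℝ}
    (hn : l.length ≤ n) (hl : ∀ ε ∈ l, 0 < ε)
    (hf : f ∈ l.foldr szlenkDerivation (dualBall 𝕜 E r)) :
    l.sum - 2 * M * r ≤ szlenkPotential M n f :=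
  le_csSup (bddAbove_szlenkValues hM hM0 n f) ⟨l, r, hn, hl, hf, rfl⟩

/-- The potential on the unit ball is attained up to `δ` on lists of radii from a finite set. -/
theorem exists_finite_lists_szlenkPotential_le (hM : HasSummableSzlenkIndexWith 𝕜 E M)
    (hM1 : 1 ≤ M) (n : ℕ) {δ : ℝ} (hδ : 0 < δ) :
    ∃ G : Set (List ℝ), G.Finite ∧ (∀ l ∈ G, l.length ≤ n ∧ ∀ ε ∈ l, 0 < ε) ∧
      ∀ g ∈ dualBall 𝕜 E 1, ∃ l ∈ G, ∃ r ∈ Set.Icc (0 : ℝ) (2 * M + 1),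
        g ∈ l.foldr szlenkDerivation (dualBall 𝕜 E r) ∧
          szlenkPotential M n g ≤ l.sum - 2 * M * r + δ := by
  have hM0 : 0 ≤ M := zero_le_one.trans hM1
  obtain ⟨G, hGfin, hG, hround⟩ := exists_finite_lists (𝕜 := 𝕜) (E := E)
    (η := δ / 2 / (n + 1)) (by positivity) (2 * M + 1) n
  refine ⟨G, hGfin, hG, fun g hg => ?_⟩
  have hlt : szlenkPotential M n g - min (δ / 2) 1 < szlenkPotential M n g :=
    sub_lt_self _ (by positivity)
  obtain ⟨_, ⟨l, r, hn, hl, hgl, rfl⟩, hv⟩ :=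
    exists_lt_of_lt_csSup ⟨_, neg_mul_dualNorm_mem_szlenkValues M n g⟩ hlt
  have hgr : dualNorm g ≤ r := foldr_szlenkDerivation_subset l _ hgl
  have hr : 0 ≤ r := (dualNorm_nonneg g).trans hgr
  have hsum := hM.sum_le hl hgl
  have hlow := neg_mul_dualNorm_le_szlenkPotential hM hM0 n g
  have h2 : 2 * M * dualNorm g ≤ 2 * M * 1 :=
    mul_le_mul_of_nonneg_left hg (by positivity)
  have hmin1 := min_le_right (δ / 2) 1
  have hmin2 := min_le_left (δ / 2) 1
  have hMr : M * r ≤ 2 * M + 1 := by linarith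
  have hrMr : r ≤ M * r := le_mul_of_one_le_left hr hM1
  obtain ⟨l', hl', hle, hsub⟩ := hround l hn fun ε hε =>
    ⟨hl ε hε, (List.single_le_sum (fun x hx => (hl x hx).le) ε hε).trans (hsum.trans hMr)⟩
  refine ⟨l', hl', r, ⟨hr, hrMr.trans hMr⟩, hsub _ hgl, ?_⟩
  have hn' : n * (δ / 2 / (n + 1)) ≤ δ / 2 := by
    rw [mul_div_assoc', div_le_iff₀ (by positivity)]
    nlinarith
  linarith

/-- One derivation raises the potential by at least the distance moved: a weak-star small
perturbation `g` of `f` inside the unit ball satisfies `‖g - f‖ + w_n(g) ≤ w_{n+1}(f) + η`. -/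
theorem eventually_dualNorm_add_szlenkPotential_le (hM : HasSummableSzlenkIndexWith 𝕜 E M)
    (hM1 : 1 ≤ M) (n : ℕ) (f : WeakDual 𝕜 E)
    {η : ℝ} (hη : 0 < η) :
    ∀ᶠ g in 𝓝 f, g ∈ dualBall 𝕜 E 1 →
      dualNorm (g - f) + szlenkPotential M n g ≤ szlenkPotential M (n + 1) f + η := by
  have hM0 : 0 ≤ M := zero_le_one.trans hM1
  have hMpos : 0 < M := zero_lt_one.trans_le hM1
  set δ := η / 5 with hδ_def
  have hδ : 0 < δ := by positivity
  set ρ := δ / (4 * M) with hρ_def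
  have hρ : 0 < ρ := by positivity
  have hMρ : 4 * M * ρ = δ := by rw [hρ_def]; field_simp
  obtain ⟨G, hGfin, hG, hGB⟩ := exists_finite_lists_szlenkPotential_le hM hM1 n hδ
  choose! l hlG r hr hgl hpot using hGB
  by_contra H
  set A : Set (WeakDual 𝕜 E) := {g | g ∈ dualBall 𝕜 E 1 ∧
    szlenkPotential M (n + 1) f + η < dualNorm (g - f) + szlenkPotential M n g} with hA
  have hfA : ∃ᶠ g in 𝓝 f, g ∈ A := by
    simpa only [hA, Set.mem_ofPred_eq, Filter.Frequently, not_and, not_lt] using H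
  have := frequently_mem_iff_neBot.1 hfA
  -- Along an ultrafilter of counterexamples, the list of radii becomes constant, and the radius of
  -- the ball and the distance to `f` converge.
  obtain ⟨u, hu⟩ := exists_ultrafilter_le (𝓝 f ⊓ 𝓟 A)
  have huf : (u : Filter (WeakDual 𝕜 E)) ≤ 𝓝 f := hu.trans inf_le_left
  have huB : ∀ᶠ g in (u : Filter (WeakDual 𝕜 E)), g ∈ A :=
    hu (mem_inf_of_right (mem_principal_self _))
  obtain ⟨L, hLG, hL⟩ : ∃ L ∈ G, ∀ᶠ g in (u : Filter (WeakDual 𝕜 E)), l g = L :=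
    (Ultrafilter.eventually_exists_mem_iff hGfin).1 (huB.mono fun g hg => ⟨_, hlG g hg.1, rfl⟩)
  obtain ⟨s, -, hs⟩ := (isCompact_Icc (a := (0 : ℝ)) (b := 2 * M + 1)).ultrafilter_le_nhds
    (u.map r) (le_principal_iff.2 (huB.mono fun g hg => hr g hg.1))
  obtain ⟨d, -, hd⟩ := (isCompact_Icc (a := (0 : ℝ)) (b := 1 + dualNorm f)).ultrafilter_le_nhds
    (u.map fun g => dualNorm (g - f)) (le_principal_iff.2 (huB.mono fun g hg =>
      ⟨dualNorm_nonneg _, (dualNorm_sub_le g f).trans (add_le_add_left hg.1 _)⟩))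
  have hs' : ∀ᶠ g in (u : Filter (WeakDual 𝕜 E)), |r g - s| < ρ :=
    hs (Metric.ball_mem_nhds s hρ)
  have hd' : ∀ᶠ g in (u : Filter (WeakDual 𝕜 E)), |dualNorm (g - f) - d| < δ :=
    hd (Metric.ball_mem_nhds d hδ)
  have hmem : ∀ᶠ g in (u : Filter (WeakDual 𝕜 E)),
      g ∈ L.foldr szlenkDerivation (dualBall 𝕜 E (s + ρ)) := by
    filter_upwards [huB, hL, hs'] with g hg hgL hgs
    rw [← hgL]
    exact foldr_szlenkDerivation_mono _ (dualBall_mono (by linarith [(abs_lt.1 hgs).2]))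
      (hgl g hg.1)
  have hclosed : IsClosed (L.foldr szlenkDerivation (dualBall 𝕜 E (s + ρ))) :=
    isClosed_foldr_szlenkDerivation L (isClosed_dualBall _)
  have hkey : d - δ + (L.sum - 2 * M * (s + ρ)) ≤ szlenkPotential M (n + 1) f := by
    by_cases hdδ : 0 < d - δ
    · have := le_szlenkPotential hM hM0 (n := n + 1) (l := (d - δ) :: L) (r := s + ρ) (f := f)
        (by simpa using (hG L hLG).1)
        (by
          intro ε hε
          rcases List.mem_cons.1 hε with rfl | hε
          · exact hdδ
          · exact (hG L hLG).2 ε hε)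
        (mem_szlenkDerivation_of_frequently hdδ.le hclosed
          (Frequently.filter_mono (hmem.and (hd'.mono fun g hg => by
            linarith [(abs_lt.1 hg).1])).frequently huf))
      rw [List.sum_cons] at this
      linarith
    · have := le_szlenkPotential hM hM0 (n := n + 1) (l := L) (r := s + ρ) (f := f)
        ((hG L hLG).1.trans n.le_succ) (hG L hLG).2
        (hclosed.mem_of_frequently_of_tendsto (hmem.frequently.filter_mono huf) tendsto_id)
      linarith
  obtain ⟨g, ⟨⟨hgB, hg⟩, rfl⟩, hgs, hgd⟩ := ((huB.and hL).and (hs'.and hd')).exists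
  have h1 := hpot g hgB
  have h2 : 2 * M * (s + ρ) ≤ 2 * M * (r g + 2 * ρ) :=
    mul_le_mul_of_nonneg_left (by linarith [(abs_lt.1 hgs).1]) (by positivity)
  have h3 := (abs_lt.1 hgd).2
  linarith

end Potential

/-! ### The dual of a `c₀`-sum -/

section C0Sum

open Filter Topology

variable {𝕜 : Type*} [RCLike 𝕜] {X : ℕ → Type*} [∀ n, NormedAddCommGroup (X n)]
  [∀ n, NormedSpace 𝕜 (X n)]

/-- The inclusion of the `k`-th summand into the `c₀`-sum. -/
noncomputable def c0SumSingle (𝕜 : Type*) [RCLike 𝕜] (X : ℕ → Type*)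
    [∀ n, NormedAddCommGroup (X n)] [∀ n, NormedSpace 𝕜 (X n)] (k : ℕ) : X k →L[𝕜] c0Sum 𝕜 X :=
  (lp.singleContinuousLinearMap 𝕜 X ∞ k).codRestrict (c0Sum 𝕜 X) fun x => by
    refine tendsto_const_nhds.congr' ?_
    filter_upwards [eventually_gt_atTop k] with n hn
    simp [Pi.single_eq_of_ne hn.ne']

theorem coe_c0SumSingle (k : ℕ) (x : X k) :
    (c0SumSingle 𝕜 X k x : lp X ∞) = lp.single ∞ k x := rfl

theorem c0Sum_norm_le_of_forall_le {x : c0Sum 𝕜 X} {C : ℝ} (hC : 0 ≤ C)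
    (h : ∀ i, ‖(x : lp X ∞) i‖ ≤ C) : ‖x‖ ≤ C :=
  lp.norm_le_of_forall_le hC h

theorem sum_c0SumSingle_apply (y : ∀ k, X k) (N i : ℕ) :
    ((∑ k ∈ Finset.range N, c0SumSingle 𝕜 X k (y k) : c0Sum 𝕜 X) : lp X ∞) i =
      if i < N then y i else 0 := by
  induction N with
  | zero => simp
  | succ N ih =>
    rw [Finset.sum_range_succ, Submodule.coe_add, lp.coeFn_add, Pi.add_apply, ih,
      coe_c0SumSingle]
    rcases lt_trichotomy i N with h | rfl | h
    · rw [lp.single_apply_ne _ _ _ h.ne, if_pos h, if_pos (h.trans N.lt_succ_self), add_zero]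
    · rw [lp.single_apply_self, if_neg (lt_irrefl _), if_pos i.lt_succ_self, zero_add]
    · rw [lp.single_apply_ne _ _ _ h.ne', if_neg h.not_gt, if_neg (by omega), add_zero]

theorem norm_sum_c0SumSingle_le {y : ∀ k, X k} (hy : ∀ k, ‖y k‖ ≤ 1) (N : ℕ) :
    ‖∑ k ∈ Finset.range N, c0SumSingle 𝕜 X k (y k)‖ ≤ 1 := by
  refine c0Sum_norm_le_of_forall_le zero_le_one fun i => ?_
  rw [sum_c0SumSingle_apply]
  split_ifs
  · exact hy i
  · simp

theorem exists_norm_sub_sum_c0SumSingle_le (x : c0Sum 𝕜 X) {η : ℝ} (hη : 0 < η) :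
    ∃ N, ‖x - ∑ k ∈ Finset.range N, c0SumSingle 𝕜 X k ((x : lp X ∞) k)‖ ≤ η := by
  have hx : Tendsto (fun n => ‖(x : lp X ∞) n‖) atTop (𝓝 0) := x.2
  obtain ⟨N, hN⟩ := eventually_atTop.1 (hx.eventually (ge_mem_nhds hη))
  refine ⟨N, c0Sum_norm_le_of_forall_le hη.le fun i => ?_⟩
  rw [Submodule.coe_sub, lp.coeFn_sub, Pi.sub_apply, sum_c0SumSingle_apply]
  split_ifs with h
  · simpa using hη.le
  · simpa using hN i (not_lt.1 h)

/-- The restriction of a functional on the `c₀`-sum to the `k`-th summand. -/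
noncomputable def c0SumDualCoord (k : ℕ) (f : WeakDual 𝕜 (c0Sum 𝕜 X)) : WeakDual 𝕜 (X k) :=
  StrongDual.toWeakDual ((WeakDual.toStrongDual f).comp (c0SumSingle 𝕜 X k))

theorem c0SumDualCoord_sub (k : ℕ) (f g : WeakDual 𝕜 (c0Sum 𝕜 X)) :
    c0SumDualCoord k (f - g) = c0SumDualCoord k f - c0SumDualCoord k g := rfl

theorem continuous_c0SumDualCoord (k : ℕ) :
    Continuous (c0SumDualCoord k : WeakDual 𝕜 (c0Sum 𝕜 X) → WeakDual 𝕜 (X k)) :=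
  WeakDual.continuous_of_continuous_eval fun x =>
    WeakDual.eval_continuous (c0SumSingle 𝕜 X k x)

theorem norm_apply_le_dualNorm {E : Type*} [NormedAddCommGroup E] [NormedSpace 𝕜 E]
    (f : WeakDual 𝕜 E) (x : E) : ‖f x‖ ≤ dualNorm f * ‖x‖ :=
  (WeakDual.toStrongDual f).le_opNorm x

/-- A functional nearly attains its norm on the unit ball, with a nonnegative real value. -/
theorem exists_dualNorm_le_norm_apply_add {E : Type*} [NormedAddCommGroup E] [NormedSpace 𝕜 E]
    (f : WeakDual 𝕜 E) {η : ℝ} (hη : 0 < η) :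
    ∃ x : E, ‖x‖ ≤ 1 ∧ dualNorm f ≤ ‖f x‖ + η ∧ ((‖f x‖ : ℝ) : 𝕜) = f x := by
  obtain ⟨x, hx, hfx⟩ := (WeakDual.toStrongDual f).exists_lt_apply_of_lt_opNorm
    (sub_lt_self ‖WeakDual.toStrongDual f‖ hη)
  obtain ⟨c, hc, hcf⟩ := RCLike.exists_norm_eq_mul_self (f x)
  have hnorm : ‖f (c • x)‖ = ‖f x‖ := by rw [map_smul, norm_smul, hc, one_mul]
  refine ⟨c • x, ?_, ?_, ?_⟩
  · rw [norm_smul, hc, one_mul]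
    exact hx.le
  · rw [hnorm]
    exact (sub_lt_iff_lt_add.1 hfx).le
  · rw [hnorm, hcf, map_smul, smul_eq_mul]

theorem sum_dualNorm_c0SumDualCoord_le (f : WeakDual 𝕜 (c0Sum 𝕜 X)) (N : ℕ) :
    ∑ k ∈ Finset.range N, dualNorm (c0SumDualCoord k f) ≤ dualNorm f := by
  refine le_of_forall_pos_le_add fun η hη => ?_
  choose x hx hfx hpos using fun k =>
    exists_dualNorm_le_norm_apply_add (c0SumDualCoord k f) (η := η / (N + 1)) (by positivity)
  have hNη : N * (η / (N + 1)) ≤ η := by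
    rw [mul_div_assoc', div_le_iff₀ (by positivity)]
    nlinarith
  have hf : f (∑ k ∈ Finset.range N, c0SumSingle 𝕜 X k (x k)) =
      ((∑ k ∈ Finset.range N, ‖c0SumDualCoord k f (x k)‖ : ℝ) : 𝕜) := by
    rw [map_sum, RCLike.ofReal_sum]
    exact Finset.sum_congr rfl fun k _ => (hpos k).symm
  have hle := norm_apply_le_dualNorm f (∑ k ∈ Finset.range N, c0SumSingle 𝕜 X k (x k))
  rw [hf, RCLike.norm_ofReal, abs_of_nonneg (Finset.sum_nonneg fun _ _ => norm_nonneg _)] at hle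
  calc ∑ k ∈ Finset.range N, dualNorm (c0SumDualCoord k f)
      ≤ ∑ k ∈ Finset.range N, (‖c0SumDualCoord k f (x k)‖ + η / (N + 1)) :=
        Finset.sum_le_sum fun k _ => hfx k
    _ = ∑ k ∈ Finset.range N, ‖c0SumDualCoord k f (x k)‖ + N * (η / (N + 1)) := by
        rw [Finset.sum_add_distrib, Finset.sum_const, Finset.card_range, nsmul_eq_mul]
    _ ≤ dualNorm f * 1 + η := add_le_add (hle.trans (mul_le_mul_of_nonneg_left
        (norm_sum_c0SumSingle_le hx N) (dualNorm_nonneg f))) hNη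
    _ = dualNorm f + η := by rw [mul_one]

theorem dualNorm_c0SumDualCoord_le (k : ℕ) (f : WeakDual 𝕜 (c0Sum 𝕜 X)) :
    dualNorm (c0SumDualCoord k f) ≤ dualNorm f :=
  (Finset.single_le_sum (f := fun k => dualNorm (c0SumDualCoord k f))
    (fun _ _ => dualNorm_nonneg _) (Finset.self_mem_range_succ k)).trans
    (sum_dualNorm_c0SumDualCoord_le f (k + 1))

/-- Together with `sum_dualNorm_c0SumDualCoord_le`: the dual of the `c₀`-sum carries the
`ℓ₁`-norm of the restrictions. -/
theorem exists_dualNorm_le_sum_c0SumDualCoord (f : WeakDual 𝕜 (c0Sum 𝕜 X)) {η : ℝ} (hη : 0 < η) :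
    ∃ N₀, ∀ N ≥ N₀,
      dualNorm f ≤ ∑ k ∈ Finset.range N, dualNorm (c0SumDualCoord k f) + η := by
  obtain ⟨x, hx, hfx, -⟩ := exists_dualNorm_le_norm_apply_add f (half_pos hη)
  have hf0 := dualNorm_nonneg f
  obtain ⟨N₀, hN₀⟩ := exists_norm_sub_sum_c0SumSingle_le x
    (η := η / 2 / (dualNorm f + 1)) (by positivity)
  refine ⟨N₀, fun N hN => ?_⟩
  set y := ∑ k ∈ Finset.range N₀, c0SumSingle 𝕜 X k ((x : lp X ∞) k) with hy
  have h1 : ‖f (x - y)‖ ≤ η / 2 := by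
    refine (norm_apply_le_dualNorm f _).trans ((mul_le_mul_of_nonneg_left hN₀ hf0).trans ?_)
    rw [mul_div_assoc', div_le_iff₀ (by positivity)]
    nlinarith
  have h2 : ‖f y‖ ≤ ∑ k ∈ Finset.range N₀, dualNorm (c0SumDualCoord k f) := by
    rw [hy, map_sum]
    refine (norm_sum_le _ _).trans (Finset.sum_le_sum fun k _ => ?_)
    refine (norm_apply_le_dualNorm (c0SumDualCoord k f) _).trans
      (mul_le_of_le_one_right (dualNorm_nonneg _) ?_)
    exact (lp.norm_apply_le_norm ENNReal.top_ne_zero (x : lp X ∞) k).trans hx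
  have h3 : ∑ k ∈ Finset.range N₀, dualNorm (c0SumDualCoord k f) ≤
      ∑ k ∈ Finset.range N, dualNorm (c0SumDualCoord k f) :=
    Finset.sum_le_sum_of_subset_of_nonneg (Finset.range_mono hN) fun _ _ _ => dualNorm_nonneg _
  have h4 : ‖f x‖ ≤ ‖f (x - y)‖ + ‖f y‖ := by
    have := norm_add_le (f (x - y)) (f y)
    rwa [← map_add, sub_add_cancel] at this
  linarith

theorem exists_sum_Ico_dualNorm_c0SumDualCoord_le (f : WeakDual 𝕜 (c0Sum 𝕜 X)) {η : ℝ}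
    (hη : 0 < η) :
    ∃ N₀, ∀ N ≥ N₀, ∀ Q ≥ N, ∑ k ∈ Finset.Ico N Q, dualNorm (c0SumDualCoord k f) ≤ η := by
  obtain ⟨N₀, hN₀⟩ := exists_dualNorm_le_sum_c0SumDualCoord f hη
  refine ⟨N₀, fun N hN Q hQ => ?_⟩
  have h1 := hN₀ N hN
  have h2 := sum_dualNorm_c0SumDualCoord_le f Q
  rw [← Finset.sum_range_add_sum_Ico _ hQ] at h2
  linarith

/-! ### Summability for the `c₀`-sum -/

/-- The potentials of the summands control the derivations of the dual ball of the `c₀`-sum. In the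
induction step a perturbation `g` of `f` is split at a finite index: on the coordinates below it,
every potential pays for the perturbation; on the others `f` is negligible, so that the perturbation
has about the norm of `g`, for which the term `-(M * ‖g k‖)` bounding the potentials pays. -/
theorem half_sum_sub_le_sum_szlenkPotential {M : ℝ} (hM1 : 1 ≤ M)
    (hM : ∀ k, HasSummableSzlenkIndexWith 𝕜 (X k) M) {l : List ℝ} (hl : ∀ ε ∈ l, 0 < ε) :
    ∀ f ∈ l.foldr szlenkDerivation (dualBall 𝕜 (c0Sum 𝕜 X) 1), ∀ N,
      l.sum / 2 - 2 * M ≤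
        ∑ k ∈ Finset.range N, szlenkPotential M l.length (c0SumDualCoord k f) := by
  have hM0 : 0 ≤ M := zero_le_one.trans hM1
  induction l with
  | nil =>
    intro f hf N
    have h1 : 2 * M * ∑ k ∈ Finset.range N, dualNorm (c0SumDualCoord k f) ≤ 2 * M * 1 :=
      mul_le_mul_of_nonneg_left ((sum_dualNorm_c0SumDualCoord_le f N).trans hf) (by positivity)
    have h2 := Finset.sum_le_sum fun k (_ : k ∈ Finset.range N) =>
      neg_mul_dualNorm_le_szlenkPotential (hM k) hM0 0 (c0SumDualCoord k f)
    rw [Finset.sum_neg_distrib, ← Finset.mul_sum] at h2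
    simp only [List.sum_nil, List.length_nil]
    linarith
  | cons ε l ih =>
    intro f hf N
    replace ih := ih fun δ hδ => hl δ (by simp [hδ])
    refine le_of_forall_pos_le_add fun η hη => ?_
    obtain ⟨N₀, hN₀⟩ := exists_sum_Ico_dualNorm_c0SumDualCoord_le f (η := η / 3) (by positivity)
    set P := max N N₀
    have hnear : ∀ᶠ g in 𝓝 f, ∀ k ∈ Finset.range P, c0SumDualCoord k g ∈ dualBall 𝕜 (X k) 1 →
        dualNorm (c0SumDualCoord k g - c0SumDualCoord k f) +
          szlenkPotential M l.length (c0SumDualCoord k g) ≤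
        szlenkPotential M (l.length + 1) (c0SumDualCoord k f) + η / 3 / (P + 1) :=
      (Finset.eventually_all _).2 fun k _ => (continuous_c0SumDualCoord k).continuousAt.eventually
        (eventually_dualNorm_add_szlenkPotential_le (hM k) hM1 l.length _ (by positivity))
    obtain ⟨g, ⟨hgK, hgf⟩, hg⟩ := ((frequently_of_mem_szlenkDerivation (hl ε (by simp)).le
      hf).and_eventually hnear).exists
    have hg1 : dualNorm g ≤ 1 := foldr_szlenkDerivation_subset l _ hgK
    obtain ⟨Q₀, hQ₀⟩ := exists_dualNorm_le_sum_c0SumDualCoord (g - f) (η := η / 3) (by positivity)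
    set Q := max P Q₀
    have hPQ : P ≤ Q := le_max_left _ _
    have hnorm := hQ₀ Q (le_max_right _ _)
    rw [← Finset.sum_range_add_sum_Ico _ hPQ] at hnorm
    simp only [c0SumDualCoord_sub] at hnorm
    have hhead := Finset.sum_le_sum fun k hk =>
      hg k hk ((dualNorm_c0SumDualCoord_le k g).trans hg1)
    rw [Finset.sum_add_distrib, Finset.sum_add_distrib, Finset.sum_const, Finset.card_range,
      nsmul_eq_mul] at hhead
    have hPη : P * (η / 3 / (P + 1)) ≤ η / 3 := by
      rw [mul_div_assoc', div_le_iff₀ (by positivity)]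
      nlinarith
    have htail : ∑ k ∈ Finset.Ico P Q, dualNorm (c0SumDualCoord k g - c0SumDualCoord k f) +
        ∑ k ∈ Finset.Ico P Q, szlenkPotential M l.length (c0SumDualCoord k g) ≤ η / 3 := by
      rw [← Finset.sum_add_distrib]
      refine (Finset.sum_le_sum fun k _ => ?_).trans (hN₀ P (le_max_right _ _) Q hPQ)
      have h1 := dualNorm_sub_le (c0SumDualCoord k g) (c0SumDualCoord k f)
      have h2 := szlenkPotential_le (hM k) hM0 l.length (c0SumDualCoord k g)
      have h3 := le_mul_of_one_le_left (dualNorm_nonneg (c0SumDualCoord k g)) hM1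
      linarith
    have hrest := ih g hgK Q
    rw [← Finset.sum_range_add_sum_Ico _ hPQ] at hrest
    -- The potentials are nonpositive, so summing over more indices only lowers the total.
    have hmono : ∑ k ∈ Finset.range P, szlenkPotential M (l.length + 1) (c0SumDualCoord k f) ≤
        ∑ k ∈ Finset.range N, szlenkPotential M (l.length + 1) (c0SumDualCoord k f) := by
      rw [← neg_le_neg_iff, ← Finset.sum_neg_distrib, ← Finset.sum_neg_distrib]
      refine Finset.sum_le_sum_of_subset_of_nonneg (Finset.range_mono (le_max_left _ _))
        fun k _ _ => ?_
      have h1 := szlenkPotential_le (hM k) hM0 (l.length + 1) (c0SumDualCoord k f)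
      have h2 := mul_nonneg hM0 (dualNorm_nonneg (c0SumDualCoord k f))
      linarith
    simp only [List.sum_cons, List.length_cons]
    linarith

end C0Sum

theorem mainTheorem1 {𝕜 : Type*} [RCLike 𝕜] (X : ℕ → Type*)
    [∀ n, NormedAddCommGroup (X n)] [∀ n, NormedSpace 𝕜 (X n)] [∀ n, CompleteSpace (X n)]
    [∀ n, TopologicalSpace.SeparableSpace (X n)]
    (hX : UniformlySummableSzlenkIndex 𝕜 X) :
    HasSummableSzlenkIndex 𝕜 (c0Sum 𝕜 X) := by
  obtain ⟨M, hM⟩ := hX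
  refine ⟨4 * max M 1, fun l hl hne => ?_⟩
  rw [← dualBall_one] at hne
  obtain ⟨f, hf⟩ := hne
  have h := half_sum_sub_le_sum_szlenkPotential (le_max_right M 1)
    (fun k => (hM k).mono (le_max_left M 1)) hl f hf 0
  rw [Finset.sum_range_zero] at h
  linarith
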